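/- \textbf{Setting.} There are finitely many customer types $i\in\mathcal I$ and servers $j\in\mathcal J$, $J=|\mathcal J|$, and a set $\mathcal L\subseteq\mathcal I\times\mathcal J$ of compatibility lines. Type-$i$ customers arrive as independent Poisson processes of rate $\lambda_i>0$, and service times at server $j$ are independent exponentials of rate $\mu_j>0$. Fix $\varepsilon>0$. The set $\mathcal A$ of actions is the set of basic feasible solutions $x^a=(x^a_{ij})_{(ij)\in\mathcal L}$ of the linear constraints $$\sum_{j:(ij)\in\mathcal L}x_{ij}=\lambda_i\ (i\in\mathcal I),\qquad \sum_{i:(ij)\in\mathcal L}x_{ij}\le\mu_j-\varepsilon\ (j\in\mathcal J),\qquad x\ge 0$$ (brought to standard form with one slack variable per server). Put $\tilde\lambda^a_j=\sum_i x^a_{ij}$ and $\rho^a_j=\tilde\lambda^a_j/\mu_j\in[0,1)$. Let $\beta>1$, and let $\alpha\ge 1$ satisfy $$\alpha\ \ge\ \frac{3(\tilde\lambda^a_j+\mu_j)\ln\rho^a_j-2\sqrt{(\mu_j-\tilde\lambda^a_j)^2+9\tilde\lambda^a_j\mu_j\ln^2\rho^a_j}}{2(\mu_j-\tilde\lambda^a_j)^2\ln\rho^a_j}\qquad\text{for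 all } a\in\mathcal A,\ j\in\mathcal J\text{ with }\tilde\lambda_j^a>0 .$$ \textbf{Episode $m$.} Time is measured from the start of the episode. An action $A_m\in\mathcal A$ is chosen as a (measurable) function of the information available at the start of the episode (for instance by a UCB rule applied to past observations). During the episode each arriving type-$i$ customer joins the virtual queue of server $j$ with probability $x^{A_m}_{ij}/\lambda_i$, independently of everything else. For $a\in\mathcal A$ and $j\in\mathcal J$ let $\underline Q^{ma}_j(t)$ and $\hat Q^{ma}_j(t)$ be the lengths (customer in service included) at time $t$ of two copies of the virtual queue of server $j$ under action $a$, with $\underline Q^{ma}_j(0)=0$ and $\mathbb P(\hat Q^{ma}_j(0)=n)=(1-\rho^a_j)(\rho^a_j)^n$, $n\ge 0$, the stationary distribution. The two copies are coupled: they have the same arrivals and the same potential service completions, which form a Poisson process of rate $\mu_j$; each arrival raises a copy by one, and each potential service completion lowers it by one if it is not empty. The arrivals, the routing choices, the potential service completions, the initial values $\hat Q_j^{ma}(0)$ and the information at the start of the episode are independent. \textbf{Lemma.} Let $m\in\mathbb N_{\ge 1}$ satisfy $m\ge C_\beta:=\frac1{2J}\exp\bigl(\beta^{1/(\beta-1)}\bigr)$,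 and let $\tau_m=\alpha\ln^\beta(2Jm)$. Then for every $t\ge\tau_m$, $$\mathbb P\bigl(\underline Q^{mA_m}_j(t)=\hat Q^{mA_m}_j(t)\ \ \forall j\in\mathcal J\bigr)\ \ge\ 1-\frac1{m^\beta}.$$ -/

import Mathlib

open MeasureTheory ProbabilityTheory Filter Topology
open scoped NNReal ENNReal

namespace QueueRouting

/-! ### Poisson processes -/

/-- A Poisson process of rate `r` (started at time `0`): a counting process with right-continuous
nondecreasing paths that starts at `0` and has independent, Poisson distributed increments. -/
structure IsPoissonProcess {Ω : Type*} [MeasurableSpace Ω] (P : Measure Ω) (r : ℝ)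
    (N : ℝ≥0 → Ω → ℕ) : Prop where
  measurable : ∀ t, Measurable (N t)
  zero : ∀ ω, N 0 ω = 0
  mono : ∀ ω, Monotone fun t => N t ω
  rightCts : ∀ ω t, ContinuousWithinAt (fun u => N u ω) (Set.Ici t) t
  increment : ∀ s t, s ≤ t →
    HasLaw (fun ω => N t ω - N s ω) (poissonMeasure (r.toNNReal * (t - s))) P
  indep : HasIndepIncrements N P

/-! ### The single-server queue driven by given arrivals and potential service completions -/

/-- The times in `(0, t]` at which the arrival path or the potential service path jumps. For
right-continuous counting paths this set is finite. -/
def eventTimes (arr svc : ℝ≥0 → ℕ) (t : ℝ≥0) : Set ℝ≥0 :=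
  {s | 0 < s ∧ s ≤ t ∧ (Function.leftLim arr s ≠ arr s ∨ Function.leftLim svc s ≠ svc s)}

/-- The update of the queue length at time `s`: every arrival increases the queue length by one,
every potential service completion decreases it by one if the queue is not empty (truncated
subtraction). Arrivals and potential completions almost surely never occur at the same time. -/
noncomputable def queueStep (arr svc : ℝ≥0 → ℕ) (q : ℕ) (s : ℝ≥0) : ℕ :=
  (q + (arr s - Function.leftLim arr s)) - (svc s - Function.leftLim svc s)

open Classical in
/-- The queue length (including the customer in service) at time `t`, of the queue with initial
length `q`, arrival counting path `arr` and potential service completion counting path `svc`: the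
updates at all event times in `(0, t]` are applied to `q` in chronological order. -/
noncomputable def queueLength (arr svc : ℝ≥0 → ℕ) (q : ℕ) (t : ℝ≥0) : ℕ :=
  if h : (eventTimes arr svc t).Finite then
    (h.toFinset.sort (· ≤ ·)).foldl (queueStep arr svc) q
  else q

/-! ### The network, the static planning LP and its basic feasible solutions -/

/-- A network with customer types `I`, servers `J`, a set of compatibility lines, Poisson arrival
rates of the types and exponential service rates of the servers. -/
structure Network (I J : Type*) where
  lines : Finset (I × J)
  arrRate : I → ℝ
  svcRate : J → ℝ
  arrRate_pos : ∀ i, 0 < arrRate i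
  svcRate_pos : ∀ j, 0 < svcRate j

namespace Network

variable {I J : Type*} [Fintype I] [Fintype J] [DecidableEq I] [DecidableEq J]

/-- The constraint matrix of the LP in standard form. The columns are the lines and, for each
server, a slack variable; the rows are the flow constraints `∑_j x_ij = λ_i` of the types and the
capacity constraints `∑_i x_ij + s_j = μ_j - ε` of the servers. -/
def constraintMatrix (net : Network I J) : Matrix (I ⊕ J) (net.lines ⊕ J) ℝ :=
  Matrix.of fun r c => match r, c with
    | Sum.inl i, Sum.inl l => if l.1.1 = i then 1 else 0
    | Sum.inl _, Sum.inr _ => 0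
    | Sum.inr j, Sum.inl l => if l.1.2 = j then 1 else 0
    | Sum.inr j, Sum.inr k => if k = j then 1 else 0

/-- The right-hand side of the LP in standard form, with slack `ε` at every server. -/
def constraintRhs (net : Network I J) (ε : ℝ) : I ⊕ J → ℝ :=
  Sum.elim net.arrRate fun j => net.svcRate j - ε

/-- `z` (rates on the lines together with the slack variables) is a basic feasible solution: it
satisfies the constraints and is supported on the columns of a basis, a set of linearly
independent columns whose number is the number of rows. -/
structure IsBasicFeasible (net : Network I J) (ε : ℝ) (z : net.lines ⊕ J → ℝ) : Prop where
  solves : net.constraintMatrix.mulVec z = net.constraintRhs ε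
  nonneg : ∀ c, 0 ≤ z c
  basis : ∃ B : Finset (net.lines ⊕ J), B.card = Fintype.card (I ⊕ J) ∧
    LinearIndependent ℝ (fun c : B => net.constraintMatrix.col c) ∧ ∀ c ∉ B, z c = 0

/-- The actions: the (line rates `x^a` of the) basic feasible solutions of the LP. -/
def Action (net : Network I J) (ε : ℝ) : Type _ :=
  {x : net.lines → ℝ // ∃ s : J → ℝ, net.IsBasicFeasible ε (Sum.elim x s)}

variable {net : Network I J} {ε : ℝ}

/-- The rate `x_ij^a` of type-`i` customers routed to server `j`, zero if `(i, j)` is not a line. -/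
def rate (a : net.Action ε) (i : I) (j : J) : ℝ :=
  if h : (i, j) ∈ net.lines then a.1 ⟨(i, j), h⟩ else 0

/-- The total arrival rate at server `j` under action `a`. -/
def totalRate (a : net.Action ε) (j : J) : ℝ := ∑ i, rate a i j

/-- The load of server `j` under action `a`. -/
noncomputable def load (a : net.Action ε) (j : J) : ℝ := totalRate a j / net.svcRate j

/-- The stationary queue length distribution of server `j` under action `a`. -/
noncomputable def stationaryProb (a : net.Action ε) (j : J) (n : ℕ) : ℝ :=
  (1 - load a j) * load a j ^ n

/-- The lower bound that server `j` and action `a` impose on the parameter `α`. -/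
noncomputable def warmupBound (a : net.Action ε) (j : J) : ℝ :=
  (3 * (totalRate a j + net.svcRate j) * Real.log (load a j)
      - 2 * Real.sqrt ((net.svcRate j - totalRate a j) ^ 2
          + 9 * totalRate a j * net.svcRate j * Real.log (load a j) ^ 2))
    / (2 * (net.svcRate j - totalRate a j) ^ 2 * Real.log (load a j))

end Network

/-! ### The random input of one episode -/

variable {I J : Type*} [Fintype I] [Fintype J] [DecidableEq I] [DecidableEq J]

/-- The random input of an episode, with time measured from the start of the episode: `arrival i`
counts the arrivals of type-`i` customers, `route a i n` is the server to which the `n`-th arriving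
type-`i` customer is routed under action `a`, `service j` counts the potential service completions
at server `j`, and `init a j` is the initial queue length at server `j` of the stationary copy under
action `a`. -/
structure EpisodeInput (net : Network I J) (ε : ℝ) (Ω : Type*) where
  arrival : I → ℝ≥0 → Ω → ℕ
  route : net.Action ε → I → ℕ → Ω → J
  service : J → ℝ≥0 → Ω → ℕ
  init : net.Action ε → J → Ω → ℕ

/-- Labels of the mutually independent sources of randomness. -/
inductive Source (I J : Type*)
  | history
  | initial
  | arrival (i : I)
  | route (i : I) (n : ℕ)
  | service (j : J)

namespace EpisodeInput

variable {net : Network I J} {ε : ℝ} {Ω : Type*}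

/-- The information carried by each source; `hist` is the information available at the start of
the episode. -/
@[reducible] def sourceSigma (E : EpisodeInput net ε Ω) (hist : MeasurableSpace Ω) :
    Source I J → MeasurableSpace Ω
  | .history => hist
  | .initial => ⨆ a, ⨆ j, MeasurableSpace.comap (E.init a j) ⊤
  | .arrival i => ⨆ t, MeasurableSpace.comap (E.arrival i t) ⊤
  | .route i n => ⨆ a, MeasurableSpace.comap (E.route a i n) ⊤
  | .service j => ⨆ t, MeasurableSpace.comap (E.service j t) ⊤

/-- The probabilistic model of an episode: type-`i` customers arrive as a Poisson process of rate
`λ_i`; under action `a` each of them is routed to server `j` with probability `x_ij^a / λ_i`; the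
potential service completions of server `j` are a Poisson process of rate `μ_j`; the initial queue
length of the stationary copy has the stationary distribution; all this is independent, also of the
information `hist` available at the start of the episode. -/
structure IsModel (E : EpisodeInput net ε Ω) (hist : MeasurableSpace Ω)
    [mΩ : MeasurableSpace Ω] (P : Measure Ω) : Prop where
  hist_le : hist ≤ mΩ
  arrival : ∀ i, IsPoissonProcess P (net.arrRate i) (E.arrival i)
  service : ∀ j, IsPoissonProcess P (net.svcRate j) (E.service j)
  route_meas : ∀ a i n j, MeasurableSet {ω | E.route a i n ω = j}
  route_prob : ∀ a i n j, P.real {ω | E.route a i n ω = j} = Network.rate a i j / net.arrRate i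
  init_meas : ∀ a j, Measurable (E.init a j)
  init_prob : ∀ a j n, P.real {ω | E.init a j ω = n} = Network.stationaryProb a j n
  indep : iIndep (E.sourceSigma hist) P

/-- The number of customers that arrive at the virtual queue of server `j` up to time `t` under
action `a`. -/
def serverArrivals (E : EpisodeInput net ε Ω) (a : net.Action ε) (j : J) (ω : Ω) (t : ℝ≥0) : ℕ :=
  ∑ i, ((Finset.range (E.arrival i t ω)).filter fun n => E.route a i n ω = j).card

/-- The queue length at time `t` of the virtual queue of server `j` under action `a` that is empty
at the start of the episode. -/
noncomputable def emptyQueue (E : EpisodeInput net ε Ω) (a : net.Action ε) (j : J) (t : ℝ≥0)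
    (ω : Ω) : ℕ :=
  queueLength (E.serverArrivals a j ω) (fun s => E.service j s ω) 0 t

/-- The queue length at time `t` of the copy of the virtual queue of server `j` under action `a`
that starts from the stationary distribution. It has the same arrivals and the same potential
service completions as `emptyQueue`. -/
noncomputable def stationaryQueue (E : EpisodeInput net ε Ω) (a : net.Action ε) (j : J) (t : ℝ≥0)
    (ω : Ω) : ℕ :=
  queueLength (E.serverArrivals a j ω) (fun s => E.service j s ω) (E.init a j ω) t

end EpisodeInput

/-- The constant `C_β`. -/
noncomputable def Cbeta (J : Type*) [Fintype J] (β : ℝ) : ℝ :=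
  1 / (2 * (Fintype.card J : ℝ)) * Real.exp (β ^ (1 / (β - 1)))

/-- The warmup time `τ_m`. -/
noncomputable def warmup (J : Type*) [Fintype J] (α β : ℝ) (m : ℕ) : ℝ :=
  α * Real.log (2 * (Fintype.card J : ℝ) * m) ^ β

end QueueRouting

/-!
The two copies of a virtual queue see the same events, so once the stationary copy has been empty
at a potential service completion, both are empty and they agree from then on. If they still differ
at time `t`, then the truncation at zero never acted on the stationary copy, and its length is its
initial value plus the arrivals minus the potential services up to time `t`. Hence fewer potential
services than initial customers plus arrivals have occurred (`lt_of_queueLength_ne`, which uses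
that a right-continuous counting path is the sum of its jumps, `sum_jumps`).

This event involves only counts at the fixed time `t`, and its probability is bounded by Chernoff's
method at the parameter `ρ^(-1/2)`: the exponential moment factorizes over the independent sources
(`lintegral_prod_blocks`), the initial value contributes at most `2`, and the Poisson counts
contribute `exp (-(√μ - √λ)² t)` (`EpisodeInput.measure_lt_le`). The arrivals at a server are a
thinned Poisson process, of which only the generating function at time `t` is needed
(`EpisodeInput.lintegral_pow_routed`). Keeping the indicator of a history event as a further factor
makes the bound hold jointly with the choice of the action.

The lower bound on `α` is at least `3 / (2 (√μ - √λ)²)`, so after the warmup time the exponent is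
at most `-ln (2Jm) ^ β`, which is at most `-β ln (2Jm)` since `m ≥ C_β`. The bounds sum to at most
`m⁻ᵝ` over the servers (`card_mul_two_mul_exp_le`), and the finitely many possible values of the
action partition the probability space (`Network.finite_action`).
-/

namespace QueueRouting

/-! ### Counting paths -/

/-- A counting path takes a new value at each of its jumps, so it has finitely many of them. -/
lemma finite_jumps {f : ℝ≥0 → ℕ} (hf : Monotone f) (t : ℝ≥0) :
    {s | s ≤ t ∧ Function.leftLim f s ≠ f s}.Finite := by
  refine Set.Finite.of_injOn (f := f) (t := Set.Iic (f t)) (fun s hs => hf hs.1) ?_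
    (Set.finite_Iic _)
  have key : ∀ x y : ℝ≥0, x < y → Function.leftLim f y ≠ f y → f x ≠ f y := by
    intro x y hxy hy
    have h1 := hf.le_leftLim hxy
    have h2 := (hf.leftLim_le le_rfl).lt_of_ne hy
    omega
  intro x hx y hy hxy
  rcases lt_trichotomy x y with h | h | h
  · exact absurd hxy (key x y h hy.2)
  · exact h
  · exact absurd hxy.symm (key y x h hx.2)

lemma finite_eventTimes {arr svc : ℝ≥0 → ℕ} (ha : Monotone arr) (hs : Monotone svc) (t : ℝ≥0) :
    (eventTimes arr svc t).Finite := by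
  refine ((finite_jumps ha t).union (finite_jumps hs t)).subset ?_
  rintro s ⟨-, hst, h | h⟩
  · exact Or.inl ⟨hst, h⟩
  · exact Or.inr ⟨hst, h⟩

/-- A right-continuous counting path is the sum of its jumps: the path minus its accumulated
jumps is continuous with integer values, hence constant on the interval `[0, t]`. -/
lemma sum_jumps {f : ℝ≥0 → ℕ} (hf : Monotone f)
    (hr : ∀ t, ContinuousWithinAt f (Set.Ici t) t) (t : ℝ≥0) (F : Finset ℝ≥0)
    (hF : ∀ s ∈ F, 0 < s ∧ s ≤ t)
    (hjump : ∀ s, 0 < s → s ≤ t → Function.leftLim f s ≠ f s → s ∈ F) :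
    ∑ s ∈ F, (f s - Function.leftLim f s) = f t - f 0 := by
  let jump : ℝ≥0 → ℤ := fun s => (f s : ℤ) - Function.leftLim f s
  let h : ℝ≥0 → ℤ := fun u => (f u : ℤ) - ∑ s ∈ F with s ≤ u, jump s
  have hnear : ∀ u : ℝ≥0, ∀ᶠ v in 𝓝 u, ∀ s ∈ F, s ≠ u → (s ≤ v ↔ s ≤ u) := by
    intro u
    rw [Filter.eventually_all_finset]
    intro s _
    rcases lt_trichotomy s u with hs | hs | hs
    · filter_upwards [lt_mem_nhds hs] with v hv _
      exact iff_of_true hv.le hs.le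
    · simp [hs]
    · filter_upwards [gt_mem_nhds hs] with v hv _
      exact iff_of_false (not_le.2 hv) (not_le.2 hs)
  have hright : ∀ u, ∀ᶠ v in 𝓝[≥] u, h v = h u := by
    intro u
    have h1 : ∀ᶠ v in 𝓝[≥] u, f v = f u := by
      have := hr u
      rw [ContinuousWithinAt, nhds_discrete, tendsto_pure] at this
      exact this
    filter_upwards [h1, nhdsWithin_le_nhds (hnear u), self_mem_nhdsWithin] with v hv hn huv
    have hset : F.filter (· ≤ v) = F.filter (· ≤ u) := by
      refine Finset.filter_congr fun s hs => ?_
      by_cases hsu : s = u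
      · subst hsu; exact iff_of_true huv le_rfl
      · exact hn s hs hsu
    simp only [h, hv, hset]
  have hleft : ∀ u, 0 < u → u ≤ t → ∀ᶠ v in 𝓝[<] u, h v = h u := by
    intro u hu hut
    have h1 : ∀ᶠ v in 𝓝[<] u, f v = Function.leftLim f u := by
      have := hf.tendsto_leftLim u
      rw [nhds_discrete, tendsto_pure] at this
      exact this
    filter_upwards [h1, nhdsWithin_le_nhds (hnear u), self_mem_nhdsWithin] with v hv hn huv
    have huv' : v < u := huv
    by_cases huF : u ∈ F
    · have hset : F.filter (· ≤ u) = insert u (F.filter (· ≤ v)) := by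
        ext s
        simp only [Finset.mem_filter, Finset.mem_insert]
        by_cases hsu : s = u
        · subst hsu; simp [huF]
        · constructor
          · rintro ⟨a, b⟩; exact Or.inr ⟨a, (hn s a hsu).2 b⟩
          · rintro (a | ⟨a, b⟩)
            · exact absurd a hsu
            · exact ⟨a, (hn s a hsu).1 b⟩
      simp only [h, hv, hset]
      rw [Finset.sum_insert (by simp [huv'])]
      simp only [jump]
      ring
    · have hset : F.filter (· ≤ v) = F.filter (· ≤ u) := by
        refine Finset.filter_congr fun s hs => hn s hs ?_
        rintro rfl; exact huF hs
      have hj : Function.leftLim f u = f u := by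
        by_contra hne; exact huF (hjump u hu hut hne)
      simp only [h, hv, hset, hj]
  have hcont : ContinuousOn h (Set.Icc 0 t) := by
    intro u hu
    refine ContinuousAt.continuousWithinAt ?_
    rw [ContinuousAt, nhds_discrete ℤ, tendsto_pure]
    rcases eq_or_ne u 0 with rfl | hu0
    · have := hright 0
      rwa [show Set.Ici (0 : ℝ≥0) = Set.univ from Set.eq_univ_of_forall fun x => zero_le (a := x),
        nhdsWithin_univ] at this
    · rw [← nhdsLT_sup_nhdsGE, eventually_sup]
      exact ⟨hleft u (pos_iff_ne_zero.2 hu0) hu.2, hright u⟩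
  have hconst := isPreconnected_Icc.constant hcont (x := 0) (y := t) (by simp) (by simp)
  have h0 : F.filter (· ≤ 0) = ∅ := by
    refine Finset.filter_eq_empty_iff.2 fun s hs => not_le.2 (hF s hs).1
  have h1 : F.filter (· ≤ t) = F := Finset.filter_true_of_mem fun s hs => (hF s hs).2
  simp only [h, h0, h1, Finset.sum_empty, jump] at hconst
  have hle : ∀ s, Function.leftLim f s ≤ f s := fun s => hf.leftLim_le le_rfl
  zify [hf (zero_le : 0 ≤ t)]
  rw [Finset.sum_congr rfl fun s _ => Nat.cast_sub (hle s)]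
  linarith

/-! ### The coupling -/

/-- If two copies that see the same events end up different, then the larger one was never
truncated at zero: otherwise both would be empty at the time of the truncation and agree from then
on. -/
lemma foldl_queueStep_ne (arr svc : ℝ≥0 → ℕ) (l : List ℝ≥0) (p q : ℕ) (hpq : p ≤ q)
    (hne : l.foldl (queueStep arr svc) p ≠ l.foldl (queueStep arr svc) q) :
    (l.map fun s => svc s - Function.leftLim svc s).sum
      < q + (l.map fun s => arr s - Function.leftLim arr s).sum := by
  induction l generalizing p q with
  | nil => simp only [List.foldl_nil] at hne; simp; omega
  | cons s l ih =>
    simp only [List.foldl_cons] at hne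
    have hle : queueStep arr svc p s ≤ queueStep arr svc q s := by unfold queueStep; omega
    have h1 := ih _ _ hle hne
    have hpos : 0 < queueStep arr svc q s := by
      by_contra h0
      apply hne
      congr 1
      omega
    simp only [List.map_cons, List.sum_cons]
    unfold queueStep at h1 hpos
    omega

/-- The coupling inequality: if a copy that starts empty differs at time `t` from a copy that starts
with `q` customers, then by time `t` fewer potential services than `q` plus the number of arrivals
have occurred. -/
lemma lt_of_queueLength_ne {arr svc : ℝ≥0 → ℕ} (ha : Monotone arr) (hs : Monotone svc)
    (har : ∀ t, ContinuousWithinAt arr (Set.Ici t) t)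
    (hsr : ∀ t, ContinuousWithinAt svc (Set.Ici t) t)
    (hs0 : svc 0 = 0) (q : ℕ) (t : ℝ≥0)
    (hne : queueLength arr svc 0 t ≠ queueLength arr svc q t) :
    svc t < q + arr t := by
  classical
  have hfin := finite_eventTimes ha hs t
  simp only [queueLength, dif_pos hfin] at hne
  have h1 := foldl_queueStep_ne arr svc _ 0 q (Nat.zero_le _) hne
  have hsum : ∀ g : ℝ≥0 → ℕ,
      ((hfin.toFinset.sort (· ≤ ·)).map g).sum = ∑ s ∈ hfin.toFinset, g s := by
    intro g
    rw [Finset.sum, ← Multiset.sum_coe, ← Multiset.map_coe, Finset.sort_eq]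
  rw [hsum, hsum, sum_jumps hs hsr t, sum_jumps ha har t] at h1
  · omega
  all_goals
    simp only [Set.Finite.mem_toFinset, eventTimes, Set.mem_ofPred_eq]
    tauto

/-! ### Expectations of products over independent blocks -/

/-- Expectations factorize over functions of disjoint blocks `κ ⁻¹' {b}` of independent
σ-algebras. -/
lemma lintegral_prod_blocks {Ω ι B : Type*} [mΩ : MeasurableSpace Ω] {P : Measure Ω}
    [IsProbabilityMeasure P] {m : ι → MeasurableSpace Ω} (h_le : ∀ i, m i ≤ mΩ)
    (hind : iIndep m P) (κ : ι → B) (s : Finset B) (F : B → Ω → ℝ≥0∞)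
    (hF : ∀ b ∈ s, Measurable[⨆ i ∈ κ ⁻¹' {b}, m i] (F b)) :
    ∫⁻ ω, ∏ b ∈ s, F b ω ∂P = ∏ b ∈ s, ∫⁻ ω, F b ω ∂P := by
  induction s using Finset.cons_induction with
  | empty => simp
  | cons b s hb ih =>
    simp only [Finset.prod_cons]
    rw [← ih fun b' hb' => hF b' (Finset.mem_cons_of_mem hb')]
    have hdisj : Disjoint (κ ⁻¹' {b}) (κ ⁻¹' (s : Set B)) := by
      rw [Set.disjoint_left]
      intro i h1 h2
      simp only [Set.mem_preimage, Set.mem_singleton_iff] at h1 h2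
      rw [h1] at h2
      exact hb h2
    refine lintegral_mul_eq_lintegral_mul_lintegral_of_independent_measurableSpace
      (iSup₂_le fun i _ => h_le i) (iSup₂_le fun i _ => h_le i)
      (indep_iSup_of_disjoint h_le hind hdisj) (hF b (Finset.mem_cons_self b s)) ?_
    refine Finset.measurable_fun_prod s fun b' hb' => ?_
    refine (hF b' (Finset.mem_cons_of_mem hb')).mono ?_ le_rfl
    refine iSup₂_le fun i hi => le_iSup₂_of_le i ?_ le_rfl
    simp only [Set.mem_preimage, Set.mem_singleton_iff] at hi ⊢
    rw [hi]
    exact hb'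

/-! ### Generating functions -/

lemma lintegral_pow_poissonMeasure (r : ℝ≥0) {y : ℝ} (hy : 0 ≤ y) :
    ∫⁻ n, ENNReal.ofReal y ^ n ∂(poissonMeasure r) = ENNReal.ofReal (Real.exp (r * (y - 1))) := by
  rw [lintegral_countable']
  have hterm : ∀ n : ℕ, ENNReal.ofReal y ^ n * poissonMeasure r {n}
      = ENNReal.ofReal (Real.exp (-r) * ((r * y) ^ n / n.factorial)) := by
    intro n
    rw [poissonMeasure_singleton, ← ENNReal.ofReal_pow hy, ← ENNReal.ofReal_mul (by positivity)]
    congr 1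
    rw [mul_pow]
    ring
  have hsum : HasSum (fun n : ℕ => Real.exp (-r) * ((r * y) ^ n / n.factorial))
      (Real.exp (-r) * Real.exp (r * y)) := by
    have := (NormedSpace.expSeries_div_hasSum_exp (r * y : ℝ)).mul_left (Real.exp (-r))
    rwa [← Real.exp_eq_exp_ℝ] at this
  rw [tsum_congr hterm, ← ENNReal.ofReal_tsum_of_nonneg (fun n => by positivity) hsum.summable,
    hsum.tsum_eq, ← Real.exp_add]
  congr 2
  ring

lemma measurable_prod_range {Ω : Type*} {m : MeasurableSpace Ω} {N : Ω → ℕ} (hN : Measurable N)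
    {Y : ℕ → Ω → ℝ≥0∞} (hY : ∀ n, Measurable (Y n)) :
    Measurable fun ω => ∏ n ∈ Finset.range (N ω), Y n ω := by
  have h : Measurable fun p : ℕ × Ω => ∏ n ∈ Finset.range p.1, Y n p.2 :=
    measurable_from_prod_countable_right fun k =>
      Finset.measurable_fun_prod (Finset.range k) fun n _ => hY n
  exact h.comp (hN.prodMk measurable_id)

/-- The expectation of a product with a random number `N` of independent factors of mean `y`, where
`N` is independent of the factors, is the generating function of `N` at `y`. -/
lemma lintegral_prod_range {Ω : Type*} [mΩ : MeasurableSpace Ω] {P : Measure Ω}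
    [IsProbabilityMeasure P] {m : Option ℕ → MeasurableSpace Ω} (h_le : ∀ i, m i ≤ mΩ)
    (hind : iIndep m P) {N : Ω → ℕ} (hN : Measurable[m none] N)
    {Y : ℕ → Ω → ℝ≥0∞} (hY : ∀ n, Measurable[m (some n)] (Y n)) {y : ℝ≥0∞}
    (hy : ∀ n, ∫⁻ ω, Y n ω ∂P = y) :
    ∫⁻ ω, ∏ n ∈ Finset.range (N ω), Y n ω ∂P = ∫⁻ ω, y ^ N ω ∂P := by
  let D : ℕ → Ω → ℝ≥0∞ := fun k => (N ⁻¹' {k}).indicator fun _ => 1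
  have hD : ∀ k, Measurable[m none] (D k) := fun k =>
    Measurable.indicator (m := m none) measurable_const (hN (measurableSet_singleton k))
  have hD' : ∀ k, Measurable (D k) := fun k => (hD k).mono (h_le _) le_rfl
  have hY' : ∀ n, Measurable (Y n) := fun n => (hY n).mono (h_le _) le_rfl
  have hsplit : ∀ (G : ℕ → Ω → ℝ≥0∞) ω, G (N ω) ω = ∑' k, D k ω * G k ω := by
    intro G ω
    rw [tsum_eq_single (N ω)]
    · simp [D]
    · intro k hk
      simp [D, hk.symm]
  have hprod : ∀ k, ∫⁻ ω, D k ω * ∏ n ∈ Finset.range k, Y n ω ∂P = (∫⁻ ω, D k ω ∂P) * y ^ k := by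
    intro k
    have := lintegral_prod_blocks h_le hind id (Finset.insertNone (Finset.range k))
      (fun o => o.elim (D k) Y) (fun o _ => by
        rcases o with _ | n
        · exact (hD k).mono (le_iSup₂_of_le none rfl le_rfl) le_rfl
        · exact (hY n).mono (le_iSup₂_of_le (some n) rfl le_rfl) le_rfl)
    simpa [Finset.prod_insertNone, hy] using this
  rw [lintegral_congr fun ω => hsplit (fun k ω => ∏ n ∈ Finset.range k, Y n ω) ω,
    lintegral_congr fun ω => hsplit (fun k _ => y ^ k) ω, lintegral_tsum, lintegral_tsum]
  · refine tsum_congr fun k => ?_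
    rw [hprod, lintegral_mul_const _ (hD' k)]
  · exact fun k => ((hD' k).mul_const _).aemeasurable
  · exact fun k => ((hD' k).mul
      (Finset.measurable_fun_prod _ fun n _ => hY' n)).aemeasurable

/-- The generating function, at `s⁻¹`, of the geometric distribution on `ℕ` with ratio `s ^ 2`. -/
lemma lintegral_inv_pow_geometric {Ω : Type*} [MeasurableSpace Ω] {P : Measure Ω}
    [IsProbabilityMeasure P] {X : Ω → ℕ} (hX : Measurable X) {s : ℝ} (hs : 0 < s) (hs1 : s < 1)
    (hprob : ∀ n, P.real {ω | X ω = n} = (1 - s ^ 2) * (s ^ 2) ^ n) :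
    ∫⁻ ω, ENNReal.ofReal s⁻¹ ^ X ω ∂P = ENNReal.ofReal (1 + s) := by
  rw [← lintegral_map (f := fun n : ℕ => ENNReal.ofReal s⁻¹ ^ n) .of_discrete hX,
    lintegral_countable']
  have hterm : ∀ n : ℕ, ENNReal.ofReal s⁻¹ ^ n * (P.map X) {n}
      = ENNReal.ofReal ((1 - s ^ 2) * s ^ n) := by
    intro n
    have h1 : P {ω | X ω = n} = ENNReal.ofReal ((1 - s ^ 2) * (s ^ 2) ^ n) := by
      rw [← hprob, ofReal_measureReal]
    rw [Measure.map_apply hX (measurableSet_singleton n)]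
    change _ * P {ω | X ω = n} = _
    rw [h1, ← ENNReal.ofReal_pow (by positivity), ← ENNReal.ofReal_mul (by positivity)]
    congr 1
    rw [inv_pow, ← pow_mul, mul_comm 2 n, pow_mul]
    field_simp
  have hsum := (hasSum_geometric_of_lt_one hs.le hs1).mul_left (1 - s ^ 2)
  rw [tsum_congr hterm, ← ENNReal.ofReal_tsum_of_nonneg _ hsum.summable, hsum.tsum_eq]
  · congr 1
    have : 1 - s ≠ 0 := by linarith
    field_simp
    ring
  · intro n
    have : 0 ≤ 1 - s ^ 2 := by nlinarith
    positivity

/-! ### The warmup time -/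

/-- Since `√(u² + 9λμ ln² ρ) ≥ 3 √(λμ) |ln ρ|`, the lower bound on `α` is at least
`3 (√μ + √λ)² / (2 (μ - λ)²) = 3 / (2 (√μ - √λ)²)`. It is stated here for `λ = μ s²`. -/
lemma one_le_mul_of_warmupBound_le {α μ s : ℝ} (hμ : 0 < μ) (hs : 0 < s) (hs1 : s < 1)
    (hα : (3 * (μ * s ^ 2 + μ) * Real.log (s ^ 2)
      - 2 * Real.sqrt ((μ - μ * s ^ 2) ^ 2 + 9 * (μ * s ^ 2) * μ * Real.log (s ^ 2) ^ 2))
      / (2 * (μ - μ * s ^ 2) ^ 2 * Real.log (s ^ 2)) ≤ α) :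
    1 ≤ α * (μ * (1 - s) ^ 2) := by
  have hl : 0 < -Real.log (s ^ 2) := by
    have := Real.log_neg (by positivity : 0 < s ^ 2) (by nlinarith)
    linarith
  obtain ⟨l, hl'⟩ : ∃ l, l = -Real.log (s ^ 2) := ⟨_, rfl⟩
  have hlog : Real.log (s ^ 2) = -l := by linarith
  rw [hlog] at hα hl
  rw [neg_neg] at hl
  have hsqrt : 3 * μ * s * l ≤ Real.sqrt ((μ - μ * s ^ 2) ^ 2
      + 9 * (μ * s ^ 2) * μ * (-l) ^ 2) := by
    apply Real.le_sqrt_of_sq_le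
    nlinarith [sq_nonneg (μ - μ * s ^ 2)]
  have h1s : 0 < 1 - s := by linarith
  have hd : 0 < μ - μ * s ^ 2 := by
    have : μ - μ * s ^ 2 = μ * (1 - s) * (1 + s) := by ring
    rw [this]; positivity
  have hden : 2 * (μ - μ * s ^ 2) ^ 2 * -l < 0 := by
    have : 0 < 2 * (μ - μ * s ^ 2) ^ 2 * l := by positivity
    linarith
  rw [div_le_iff_of_neg hden] at hα
  have h2 : 3 * (μ * (1 + s) ^ 2) * l ≤ α * (2 * (μ - μ * s ^ 2) ^ 2 * l) := by
    nlinarith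
  have h3 : α * (2 * (μ - μ * s ^ 2) ^ 2 * l)
      = (2 * (α * (μ * (1 - s) ^ 2))) * (μ * (1 + s) ^ 2 * l) := by ring
  have h4 : 0 < μ * (1 + s) ^ 2 * l := by positivity
  have h5 : 3 ≤ 2 * (α * (μ * (1 - s) ^ 2)) := by
    by_contra hlt
    have := mul_lt_mul_of_pos_right (not_le.1 hlt) h4
    linarith
  linarith

/-- After the warmup time, the exponential bound of a single server is so small that the sum over
all `J` servers is at most `m⁻ᵝ`. The condition on `m` says `ln (2Jm) ^ (β - 1) ≥ β`. -/
lemma card_mul_two_mul_exp_le {J : Type*} [Fintype J] [Nonempty J] {α β c t : ℝ} {m : ℕ}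
    (hβ : 1 < β) (hm : 1 ≤ m) (hmβ : Cbeta J β ≤ m) (hc : 0 ≤ c) (hαc : 1 ≤ α * c)
    (ht : warmup J α β m ≤ t) :
    Fintype.card J * (2 * Real.exp (-(c * t))) ≤ 1 / (m : ℝ) ^ β := by
  have hJ : (1 : ℝ) ≤ Fintype.card J := by exact_mod_cast Fintype.card_pos
  have hm' : (1 : ℝ) ≤ m := by exact_mod_cast hm
  have hJ2 : (0 : ℝ) < 2 * Fintype.card J := by linarith
  have hpos : (0 : ℝ) < 2 * Fintype.card J * m := by positivity
  unfold warmup at ht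
  set L := Real.log (2 * (Fintype.card J : ℝ) * m) with hL
  have hLb : β ^ (1 / (β - 1)) ≤ L := by
    rw [hL, Real.le_log_iff_exp_le hpos]
    have h1 := mul_le_mul_of_nonneg_left hmβ hJ2.le
    unfold Cbeta at h1
    rwa [← mul_assoc, mul_one_div_cancel hJ2.ne', one_mul] at h1
  have hL0 : 0 < L := (Real.rpow_pos_of_pos (by linarith) _).trans_le hLb
  have hLβ : β ≤ L ^ (β - 1) := by
    have h1 := Real.rpow_le_rpow (by positivity) hLb (by linarith : 0 ≤ β - 1)
    rwa [← Real.rpow_mul (by linarith), one_div_mul_cancel (by linarith), Real.rpow_one] at h1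
  have hLL : β * L ≤ L ^ β := by
    have h1 : L ^ β = L ^ (β - 1) * L := by
      rw [← Real.rpow_add_one hL0.ne']; congr 1; ring
    rw [h1]
    exact mul_le_mul_of_nonneg_right hLβ hL0.le
  have hexp : Real.exp (-(c * t)) ≤ ((2 * Fintype.card J : ℝ) * m) ^ (-β) := by
    rw [Real.rpow_def_of_pos hpos, ← hL, Real.exp_le_exp]
    have h1 : c * (α * L ^ β) ≤ c * t := mul_le_mul_of_nonneg_left ht hc
    have h2 : 1 * L ^ β ≤ α * c * L ^ β := mul_le_mul_of_nonneg_right hαc (by positivity)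
    nlinarith
  have hJβ : (2 * Fintype.card J : ℝ) * (2 * Fintype.card J : ℝ) ^ (-β) ≤ 1 := by
    have h1 : (2 * Fintype.card J : ℝ) * (2 * Fintype.card J : ℝ) ^ (-β)
        = (2 * Fintype.card J : ℝ) ^ (-β + 1) := by
      rw [Real.rpow_add_one hJ2.ne', mul_comm]
    rw [h1]
    exact Real.rpow_le_one_of_one_le_of_nonpos (by linarith) (by linarith)
  calc Fintype.card J * (2 * Real.exp (-(c * t)))
      ≤ Fintype.card J * (2 * ((2 * Fintype.card J : ℝ) * m) ^ (-β)) := by gcongr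
    _ = (2 * Fintype.card J : ℝ) * (2 * Fintype.card J : ℝ) ^ (-β) * (m : ℝ) ^ (-β) := by
      rw [Real.mul_rpow hJ2.le (by positivity)]; ring
    _ ≤ 1 * (m : ℝ) ^ (-β) := by gcongr
    _ = 1 / (m : ℝ) ^ β := by rw [one_mul, Real.rpow_neg (by positivity), one_div]

/-! ### Actions -/

namespace Network

variable {I J : Type*} [Fintype I] [Fintype J] [DecidableEq I] [DecidableEq J]
  {net : Network I J} {ε : ℝ}

/-- A basic feasible solution is determined by its basis, so there are finitely many actions. -/
instance finite_action : Finite (net.Action ε) := by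
  choose s hs using fun a : net.Action ε => a.2
  choose B hB using fun a => (hs a).basis
  refine Finite.of_injective B fun a b hab => ?_
  set d : net.lines ⊕ J → ℝ := Sum.elim a.1 (s a) - Sum.elim b.1 (s b) with hd
  have hd0 : ∀ c ∉ B a, d c = 0 := by
    intro c hc
    simp [hd, (hB a).2.2 c hc, (hB b).2.2 c (hab ▸ hc)]
  have hAd : net.constraintMatrix.mulVec d = 0 := by
    rw [hd, Matrix.mulVec_sub, (hs a).solves, (hs b).solves, sub_self]
  have hli := (hB a).2.1
  rw [Fintype.linearIndependent_iff] at hli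
  have hdz : ∀ c : B a, d c = 0 := by
    apply hli (fun c => d c)
    rw [Matrix.mulVec_eq_sum] at hAd
    rw [Finset.sum_coe_sort (B a) fun c => d c • net.constraintMatrix.col c]
    rw [Finset.sum_subset (Finset.subset_univ _) fun c _ hc => by rw [hd0 c hc, zero_smul]]
    simpa [Matrix.col] using hAd
  apply Subtype.ext
  funext l
  have : d (Sum.inl l) = 0 := by
    by_cases hc : Sum.inl l ∈ B a
    · exact hdz ⟨_, hc⟩
    · exact hd0 _ hc
  simpa [hd, sub_eq_zero] using this

lemma rate_nonneg (a : net.Action ε) (i : I) (j : J) : 0 ≤ rate a i j := by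
  obtain ⟨s, hs⟩ := a.2
  unfold rate
  split_ifs with h
  · exact hs.nonneg (Sum.inl ⟨(i, j), h⟩)
  · exact le_rfl

lemma totalRate_nonneg (a : net.Action ε) (j : J) : 0 ≤ totalRate a j :=
  Finset.sum_nonneg fun i _ => rate_nonneg a i j

lemma totalRate_lt_svcRate (hε : 0 < ε) (a : net.Action ε) (j : J) :
    totalRate a j < net.svcRate j := by
  obtain ⟨s, hs⟩ := a.2
  have h1 := congrFun hs.solves (Sum.inr j)
  have h2 := hs.nonneg (Sum.inr j)
  have h3 : totalRate a j = ∑ l : net.lines, if l.1.2 = j then a.1 l else 0 := by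
    rw [Finset.sum_coe_sort_eq_attach]
    unfold totalRate
    have h4 : ∀ i, rate a i j = ∑ l ∈ net.lines.attach, if l.1 = (i, j) then a.1 l else 0 := by
      intro i
      unfold rate
      split_ifs with h
      · rw [Finset.sum_eq_single ⟨(i, j), h⟩]
        · simp
        · intro l _ hl
          rw [if_neg fun h' => hl (Subtype.ext h')]
        · simp
      · refine (Finset.sum_eq_zero fun l _ => if_neg ?_).symm
        intro h'
        exact h (h' ▸ l.2)
    rw [Finset.sum_congr rfl fun i _ => h4 i, Finset.sum_comm]
    refine Finset.sum_congr rfl fun l _ => ?_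
    rw [Finset.sum_eq_single l.1.1]
    · simp [Prod.ext_iff]
    · intro i _ hi
      rw [if_neg fun h' => hi (by rw [h'])]
    · simp
  simp only [Matrix.mulVec, dotProduct, constraintMatrix, constraintRhs, Matrix.of_apply,
    Fintype.sum_sum_type, Sum.elim_inl, Sum.elim_inr, ite_mul, one_mul, zero_mul,
    Finset.sum_ite_eq', Finset.mem_univ, if_true] at h1
  rw [← h3] at h1
  simp only [Sum.elim_inr] at h2
  linarith

end Network

namespace EpisodeInput

variable {I J : Type*} [Fintype I] [Fintype J] [DecidableEq I] [DecidableEq J]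
  {net : Network I J} {ε : ℝ} {Ω : Type*} {hist : MeasurableSpace Ω}

/-! ### The sources of randomness of an episode -/

lemma measurable_arrival (E : EpisodeInput net ε Ω) (i : I) (t : ℝ≥0) :
    Measurable[E.sourceSigma hist (.arrival i)] (E.arrival i t) :=
  Measurable.of_comap_le (le_iSup (fun t => MeasurableSpace.comap (E.arrival i t) ⊤) t)

lemma measurable_service (E : EpisodeInput net ε Ω) (j : J) (t : ℝ≥0) :
    Measurable[E.sourceSigma hist (.service j)] (E.service j t) :=
  Measurable.of_comap_le (le_iSup (fun t => MeasurableSpace.comap (E.service j t) ⊤) t)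

lemma measurable_init (E : EpisodeInput net ε Ω) (a : net.Action ε) (j : J) :
    Measurable[E.sourceSigma hist .initial] (E.init a j) :=
  Measurable.of_comap_le
    (le_iSup₂ (f := fun a j => MeasurableSpace.comap (E.init a j) ⊤) a j)

lemma measurable_route_ite (E : EpisodeInput net ε Ω) (a : net.Action ε) (i : I) (n : ℕ) (j : J)
    (c : ℝ≥0∞) : Measurable[E.sourceSigma hist (.route i n)]
      fun ω => if E.route a i n ω = j then c else 1 := by
  have h : Measurable[E.sourceSigma hist (.route i n), ⊤] (E.route a i n) :=
    Measurable.of_comap_le (le_iSup (fun a => MeasurableSpace.comap (E.route a i n) ⊤) a)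
  exact Measurable.comp (g := fun k => if k = j then c else 1) measurable_from_top h

lemma prod_range_ite_eq_pow (E : EpisodeInput net ε Ω) (a : net.Action ε) (i : I) (j : J)
    (N : ℕ) (ω : Ω) (c : ℝ≥0∞) :
    ∏ n ∈ Finset.range N, (if E.route a i n ω = j then c else 1)
      = c ^ ((Finset.range N).filter fun n => E.route a i n ω = j).card := by
  rw [Finset.prod_ite, Finset.prod_const, Finset.prod_const_one, mul_one]

variable [mΩ : MeasurableSpace Ω] {P : Measure Ω} {E : EpisodeInput net ε Ω}

lemma sourceSigma_le (hE : E.IsModel hist P) (k : Source I J) : E.sourceSigma hist k ≤ mΩ := by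
  cases k with
  | history => exact hE.hist_le
  | initial => exact iSup₂_le fun a j => (hE.init_meas a j).comap_le
  | arrival i => exact iSup_le fun t => ((hE.arrival i).measurable t).comap_le
  | route i n =>
    refine iSup_le fun a => ?_
    rintro _ ⟨s, -, rfl⟩
    have : E.route a i n ⁻¹' s = ⋃ j ∈ s, {ω | E.route a i n ω = j} := by ext; simp
    rw [this]
    exact MeasurableSet.biUnion s.to_countable fun j _ => hE.route_meas a i n j
  | service j => exact iSup_le fun t => ((hE.service j).measurable t).comap_le

/-! ### Arrivals at a virtual queue -/

/-- The type-`i` customers routed to server `j` up to time `t` have the generating function of the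
Poisson distribution with parameter `x_ij t`. -/
lemma lintegral_pow_routed [IsProbabilityMeasure P] (hE : E.IsModel hist P) (a : net.Action ε)
    (i : I) (j : J) (t : ℝ≥0) {z : ℝ} (hz : 1 ≤ z) :
    ∫⁻ ω, ENNReal.ofReal z ^
        ((Finset.range (E.arrival i t ω)).filter fun n => E.route a i n ω = j).card ∂P
      = ENNReal.ofReal (Real.exp (Network.rate a i j * t * (z - 1))) := by
  have hlam := net.arrRate_pos i
  have hp : 0 ≤ Network.rate a i j / net.arrRate i :=
    div_nonneg (Network.rate_nonneg a i j) hlam.le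
  set y : ℝ := 1 + (z - 1) * (Network.rate a i j / net.arrRate i) with hy
  have hz' : 0 ≤ z - 1 := by linarith
  have hmean : ∀ n, ∫⁻ ω, (if E.route a i n ω = j then ENNReal.ofReal z else 1) ∂P
      = ENNReal.ofReal y := by
    intro n
    have h1 : ∀ ω, (if E.route a i n ω = j then ENNReal.ofReal z else 1)
        = 1 + {ω | E.route a i n ω = j}.indicator (fun _ => ENNReal.ofReal (z - 1)) ω := by
      intro ω
      by_cases h : E.route a i n ω = j
      · rw [if_pos h, Set.indicator_of_mem (by exact h), ← ENNReal.ofReal_one,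
          ← ENNReal.ofReal_add zero_le_one hz']
        congr 1
        ring
      · rw [if_neg h, Set.indicator_of_notMem (by exact h), add_zero]
    rw [lintegral_congr h1, lintegral_add_left measurable_const,
      lintegral_indicator_const (hE.route_meas a i n j), lintegral_const, measure_univ, mul_one,
      ← ofReal_measureReal, hE.route_prob, ← ENNReal.ofReal_mul hz', ← ENNReal.ofReal_one,
      ← ENNReal.ofReal_add zero_le_one (mul_nonneg hz' hp)]
  have hinj : Function.Injective fun o : Option ℕ => o.elim (Source.arrival i : Source I J)
      (Source.route i) := by
    rintro (_ | m) (_ | n) h <;> simp_all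
  have hind := iIndep.precomp hinj hE.indep
  have h1 := lintegral_prod_range (fun o => sourceSigma_le hE _) hind
    (measurable_arrival E i t)
    (Y := fun n ω => if E.route a i n ω = j then ENNReal.ofReal z else 1)
    (fun n => measurable_route_ite E a i n j (ENNReal.ofReal z)) hmean
  simp only [prod_range_ite_eq_pow] at h1
  have h2 : HasLaw (E.arrival i t) (poissonMeasure ((net.arrRate i).toNNReal * t)) P := by
    simpa [(hE.arrival i).zero] using (hE.arrival i).increment 0 t zero_le
  rw [h1, h2.lintegral_comp (f := fun n => ENNReal.ofReal y ^ n)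
    (measurable_from_nat).aemeasurable, lintegral_pow_poissonMeasure _ (by positivity)]
  congr 2
  rw [hy, NNReal.coe_mul, Real.coe_toNNReal _ hlam.le]
  field_simp
  ring

lemma serverArrivals_mono (hE : E.IsModel hist P) (a : net.Action ε) (j : J) (ω : Ω) :
    Monotone (E.serverArrivals a j ω) := by
  intro s t hst
  refine Finset.sum_le_sum fun i _ => Finset.card_le_card (Finset.filter_subset_filter _ ?_)
  exact Finset.range_subset_range.2 ((hE.arrival i).mono ω hst)

lemma serverArrivals_rightCts (hE : E.IsModel hist P) (a : net.Action ε) (j : J) (ω : Ω)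
    (t : ℝ≥0) : ContinuousWithinAt (E.serverArrivals a j ω) (Set.Ici t) t := by
  have h : ∀ i, ∀ᶠ u in 𝓝[≥] t, E.arrival i u ω = E.arrival i t ω := by
    intro i
    have := (hE.arrival i).rightCts ω t
    rwa [ContinuousWithinAt, nhds_discrete, tendsto_pure] at this
  rw [ContinuousWithinAt, nhds_discrete, tendsto_pure]
  filter_upwards [eventually_all.2 h] with u hu
  simp only [serverArrivals, hu]

/-! ### The probability that the copies differ -/

/-- The coupling inequality for the two copies of the virtual queue. -/
lemma lt_of_emptyQueue_ne (hE : E.IsModel hist P) (a : net.Action ε) (j : J) (t : ℝ≥0) (ω : Ω)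
    (hne : E.emptyQueue a j t ω ≠ E.stationaryQueue a j t ω) :
    E.service j t ω < E.init a j ω + E.serverArrivals a j ω t :=
  lt_of_queueLength_ne (serverArrivals_mono hE a j ω) ((hE.service j).mono ω)
    (serverArrivals_rightCts hE a j ω) ((hE.service j).rightCts ω)
    ((hE.service j).zero ω) _ t hne

/-- The division of the sources into independent blocks: the history, the initial values, the
services, and for each type its arrivals together with its routing choices. -/
def sourceBlock : Source I J → Fin 3 ⊕ I
  | .history => Sum.inl 0
  | .initial => Sum.inl 1
  | .service _ => Sum.inl 2
  | .arrival i => Sum.inr i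
  | .route i _ => Sum.inr i

/-- The Chernoff bound for the event of `lt_of_emptyQueue_ne`, at the parameter `s⁻¹` with `s = √ρ`,
which minimizes the contribution of the Poisson counts. The factor
`1 + s ≤ 2` comes from the stationary initial value, and
`μ (1 - s)² = (√μ - √λ)²`. -/
lemma measure_lt_le [IsProbabilityMeasure P] (hE : E.IsModel hist P) (a : net.Action ε) (j : J)
    (t : ℝ≥0) {H : Set Ω} (hH : MeasurableSet[hist] H) {s : ℝ} (hs : 0 < s) (hs1 : s < 1)
    (hload : Network.totalRate a j = net.svcRate j * s ^ 2) :
    P (H ∩ {ω | E.service j t ω < E.init a j ω + E.serverArrivals a j ω t})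
      ≤ P H * ENNReal.ofReal (2 * Real.exp (-(net.svcRate j * (1 - s) ^ 2 * t))) := by
  have hμ := net.svcRate_pos j
  have hz : 1 ≤ s⁻¹ := (one_le_inv₀ hs).2 hs1.le
  let Z : ℝ≥0∞ := ENNReal.ofReal s⁻¹
  let W : ℝ≥0∞ := ENNReal.ofReal s
  have hZ : 1 ≤ Z := ENNReal.one_le_ofReal.2 hz
  have hZW : Z * W = 1 := by
    rw [← ENNReal.ofReal_mul (by positivity), inv_mul_cancel₀ hs.ne', ENNReal.ofReal_one]
  let C : I → Ω → ℕ := fun i ω =>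
    ((Finset.range (E.arrival i t ω)).filter fun n => E.route a i n ω = j).card
  let F : Fin 3 ⊕ I → Ω → ℝ≥0∞ := Sum.elim
    ![H.indicator fun _ => 1, fun ω => Z ^ E.init a j ω, fun ω => W ^ E.service j t ω]
    fun i ω => Z ^ C i ω
  have hle : ∀ k, E.sourceSigma hist k ≤
      ⨆ k' ∈ sourceBlock ⁻¹' {sourceBlock k}, E.sourceSigma hist k' := fun k =>
    le_iSup₂_of_le k rfl le_rfl
  have hF : ∀ b, Measurable[⨆ k ∈ sourceBlock ⁻¹' {b}, E.sourceSigma hist k] (F b) := by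
    rintro (b | i)
    · fin_cases b
      · exact (Measurable.indicator (m := hist) measurable_const hH).mono (hle .history) le_rfl
      · exact ((measurable_from_nat (f := fun n => Z ^ n)).comp (measurable_init E a j)).mono
          (hle .initial) le_rfl
      · exact ((measurable_from_nat (f := fun n => W ^ n)).comp (measurable_service E j t)).mono
          (hle (.service j)) le_rfl
    · simp only [F, C, Sum.elim_inr, ← prod_range_ite_eq_pow]
      exact measurable_prod_range ((measurable_arrival E i t).mono (hle (.arrival i)) le_rfl)
        fun n => (measurable_route_ite E a i n j Z).mono (hle (.route i n)) le_rfl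
  have hprod := lintegral_prod_blocks (sourceSigma_le hE) hE.indep sourceBlock Finset.univ F
    fun b _ => hF b
  simp only [Fintype.prod_sum_type, Fin.prod_univ_three] at hprod
  have hmeas : ∀ b, Measurable (F b) := fun b =>
    (hF b).mono (iSup₂_le fun k _ => sourceSigma_le hE k) le_rfl
  have h1 : P (H ∩ {ω | E.service j t ω < E.init a j ω + E.serverArrivals a j ω t})
      ≤ ∫⁻ ω, F (Sum.inl 0) ω * F (Sum.inl 1) ω * F (Sum.inl 2) ω * ∏ i, F (Sum.inr i) ω ∂P := by
    refine meas_le_lintegral₀ ?_ ?_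
    · exact ((((hmeas _).mul (hmeas _)).mul (hmeas _)).mul
        (Finset.measurable_fun_prod _ fun i _ => hmeas _)).aemeasurable
    · rintro ω ⟨hω, hlt⟩
      have hlt' : E.service j t ω < E.init a j ω + ∑ i, C i ω := hlt
      simp only [F, Sum.elim_inl, Sum.elim_inr, Matrix.cons_val_zero, Matrix.cons_val_one,
        Matrix.cons_val, Set.indicator_of_mem hω, one_mul, Finset.prod_pow_eq_pow_sum]
      calc (1 : ℝ≥0∞) = Z ^ E.service j t ω * W ^ E.service j t ω := by
            rw [← mul_pow, hZW, one_pow]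
        _ ≤ Z ^ (E.init a j ω + ∑ i, C i ω) * W ^ E.service j t ω := by
            gcongr
        _ = Z ^ E.init a j ω * W ^ E.service j t ω * Z ^ ∑ i, C i ω := by
            rw [pow_add]; ring
  have hinit : ∫⁻ ω, F (Sum.inl 1) ω ∂P = ENNReal.ofReal (1 + s) := by
    refine lintegral_inv_pow_geometric (hE.init_meas a j) hs hs1 fun n => ?_
    rw [hE.init_prob, Network.stationaryProb, Network.load, hload, mul_div_cancel_left₀ _ hμ.ne']
  have hsvc : ∫⁻ ω, F (Sum.inl 2) ω ∂P
      = ENNReal.ofReal (Real.exp (net.svcRate j * t * (s - 1))) := by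
    have h2 : HasLaw (E.service j t) (poissonMeasure ((net.svcRate j).toNNReal * t)) P := by
      simpa [(hE.service j).zero] using (hE.service j).increment 0 t zero_le
    have h3 := h2.lintegral_comp (f := fun n => ENNReal.ofReal s ^ n)
      (measurable_from_nat).aemeasurable
    rw [lintegral_pow_poissonMeasure _ hs.le, NNReal.coe_mul, Real.coe_toNNReal _ hμ.le] at h3
    exact h3
  have harr : ∏ i, ∫⁻ ω, F (Sum.inr i) ω ∂P
      = ENNReal.ofReal (Real.exp (Network.totalRate a j * t * (s⁻¹ - 1))) := by
    have h4 : ∀ i, ∫⁻ ω, F (Sum.inr i) ω ∂P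
        = ENNReal.ofReal (Real.exp (Network.rate a i j * t * (s⁻¹ - 1))) :=
      fun i => lintegral_pow_routed hE a i j t hz
    rw [Finset.prod_congr rfl fun i _ => h4 i,
      ← ENNReal.ofReal_prod_of_nonneg fun i _ => (Real.exp_pos _).le, ← Real.exp_sum,
      ← Finset.sum_mul, ← Finset.sum_mul, Network.totalRate]
  have hhist : ∫⁻ ω, F (Sum.inl 0) ω ∂P = P H := lintegral_indicator_one (hE.hist_le _ hH)
  refine h1.trans ?_
  rw [hprod, hinit, hsvc, harr, hhist, mul_assoc, mul_assoc]
  gcongr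
  rw [← ENNReal.ofReal_mul (by positivity), ← ENNReal.ofReal_mul (by positivity), ← Real.exp_add]
  apply ENNReal.ofReal_le_ofReal
  have hexp : net.svcRate j * t * (s - 1) + Network.totalRate a j * t * (s⁻¹ - 1)
      = -(net.svcRate j * (1 - s) ^ 2 * t) := by
    rw [hload]
    field_simp
    ring
  rw [hexp]
  gcongr
  linarith

/-- A server that receives no customers starts empty almost surely. -/
lemma measure_init_ne_zero [IsProbabilityMeasure P] (hE : E.IsModel hist P) (a : net.Action ε)
    (j : J) (h0 : Network.totalRate a j = 0) : P {ω | E.init a j ω ≠ 0} = 0 := by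
  have h1 : P.real {ω | E.init a j ω = 0} = 1 := by
    rw [hE.init_prob, Network.stationaryProb, Network.load, h0]
    simp
  have hm : MeasurableSet {ω | E.init a j ω = 0} := hE.init_meas a j (measurableSet_singleton 0)
  have h2 := (prob_compl_eq_zero_iff hm (μ := P)).2 (by
    rw [← ofReal_measureReal, h1, ENNReal.ofReal_one])
  exact h2

/-- For one server and one action, the bound on the probability that the copies differ, divided
evenly among the servers. -/
lemma measure_ne_le [IsProbabilityMeasure P] (hε : 0 < ε) {α β : ℝ} (hβ : 1 < β) {m : ℕ}
    (hm : 1 ≤ m) (hmβ : Cbeta J β ≤ m) (hE : E.IsModel hist P) (a : net.Action ε) (j : J)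
    (hα : 0 < Network.totalRate a j → Network.warmupBound a j ≤ α) (t : ℝ≥0)
    (ht : warmup J α β m ≤ t) {H : Set Ω} (hH : MeasurableSet[hist] H) :
    P (H ∩ {ω | E.emptyQueue a j t ω ≠ E.stationaryQueue a j t ω})
      ≤ P H * ENNReal.ofReal (1 / (m : ℝ) ^ β / Fintype.card J) := by
  have hμ := net.svcRate_pos j
  rcases (Network.totalRate_nonneg a j).eq_or_lt' with h0 | hpos
  · have : P (H ∩ {ω | E.emptyQueue a j t ω ≠ E.stationaryQueue a j t ω}) = 0 := by
      refine measure_mono_null ?_ (measure_init_ne_zero hE a j h0)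
      rintro ω ⟨-, hω⟩ hi
      exact hω (by rw [emptyQueue, stationaryQueue, hi])
    rw [this]
    exact zero_le
  · set s := Real.sqrt (Network.load a j) with hs
    have hlpos : 0 < Network.load a j := div_pos hpos hμ
    have hl1 : Network.load a j < 1 := (div_lt_one hμ).2 (Network.totalRate_lt_svcRate hε a j)
    have hs2 : s ^ 2 = Network.load a j := Real.sq_sqrt hlpos.le
    have hs0 : 0 < s := Real.sqrt_pos.2 hlpos
    have hs1 : s < 1 := by nlinarith
    have hload : Network.totalRate a j = net.svcRate j * s ^ 2 := by
      rw [hs2, Network.load, mul_div_cancel₀ _ hμ.ne']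
    have hαc : 1 ≤ α * (net.svcRate j * (1 - s) ^ 2) := by
      apply one_le_mul_of_warmupBound_le hμ hs0 hs1
      have := hα hpos
      rwa [Network.warmupBound, ← hs2, hload] at this
    have : Nonempty J := ⟨j⟩
    have hnum := card_mul_two_mul_exp_le hβ hm hmβ (by positivity) hαc ht
    refine (measure_mono ?_).trans ((measure_lt_le hE a j t hH hs0 hs1 hload).trans ?_)
    · exact Set.inter_subset_inter_right _ fun ω hω => lt_of_emptyQueue_ne hE a j t ω hω
    · gcongr
      rw [le_div_iff₀ (by exact_mod_cast Fintype.card_pos)]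
      linarith

end EpisodeInput

end QueueRouting

theorem mainTheorem3 {I J : Type*} [Fintype I] [Fintype J] [DecidableEq I] [DecidableEq J]
    (net : QueueRouting.Network I J) (ε : ℝ) (hε : 0 < ε)
    (α β : ℝ) (hβ : 1 < β) (hα : 1 ≤ α)
    (hα' : ∀ (a : net.Action ε) (j : J), 0 < QueueRouting.Network.totalRate a j →
      QueueRouting.Network.warmupBound a j ≤ α)
    (m : ℕ) (hm : 1 ≤ m) (hmβ : QueueRouting.Cbeta J β ≤ m)
    {Ω : Type*}
    -- the information at the start of episode `m`, the action chosen on its basis, and the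
    -- random input of the episode
    (hist : MeasurableSpace Ω) [MeasurableSpace Ω] (P : Measure Ω) [IsProbabilityMeasure P]
    (A : Ω → net.Action ε)
    (hA : ∀ a, MeasurableSet[hist] {ω | A ω = a})
    (E : QueueRouting.EpisodeInput net ε Ω) (hE : E.IsModel hist P)
    (t : ℝ≥0) (ht : QueueRouting.warmup J α β m ≤ t) :
    1 - 1 / (m : ℝ) ^ β ≤
        P.real {ω | ∀ j, E.emptyQueue (A ω) j t ω = E.stationaryQueue (A ω) j t ω} ∧
      P.real {ω | ∃ j, E.emptyQueue (A ω) j t ω ≠ E.stationaryQueue (A ω) j t ω} ≤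
        1 / (m : ℝ) ^ β := by
  have hb : 0 ≤ 1 / (m : ℝ) ^ β := by positivity
  have hbad : P {ω | ∃ j, E.emptyQueue (A ω) j t ω ≠ E.stationaryQueue (A ω) j t ω}
      ≤ ENNReal.ofReal (1 / (m : ℝ) ^ β) := by
    have := Fintype.ofFinite (net.Action ε)
    have hcover : {ω | ∃ j, E.emptyQueue (A ω) j t ω ≠ E.stationaryQueue (A ω) j t ω}
        ⊆ ⋃ a, ⋃ j, {ω | A ω = a} ∩ {ω | E.emptyQueue a j t ω ≠ E.stationaryQueue a j t ω} := by
      rintro ω ⟨j, hj⟩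
      exact Set.mem_iUnion₂.2 ⟨A ω, j, rfl, hj⟩
    have hone : ∑ a, P {ω | A ω = a} = 1 := by
      rw [← measure_biUnion_finset, ← measure_univ (μ := P)]
      · congr 1
        ext ω
        simp
      · intro a _ b _ hab
        exact Set.disjoint_left.2 fun ω h1 h2 => hab (h1.symm.trans h2)
      · exact fun a _ => hE.hist_le _ (hA a)
    calc _ ≤ ∑ a, ∑ j, P ({ω | A ω = a}
          ∩ {ω | E.emptyQueue a j t ω ≠ E.stationaryQueue a j t ω}) :=
        (measure_mono hcover).trans ((measure_iUnion_fintype_le _ _).trans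
          (Finset.sum_le_sum fun a _ => measure_iUnion_fintype_le _ _))
      _ ≤ ∑ a, ∑ _j : J, P {ω | A ω = a}
          * ENNReal.ofReal (1 / (m : ℝ) ^ β / Fintype.card J) := by
        gcongr with a _ j _
        exact QueueRouting.EpisodeInput.measure_ne_le hε hβ hm hmβ hE a j (hα' a j) t ht (hA a)
      _ = ENNReal.ofReal (Fintype.card J * (1 / (m : ℝ) ^ β / Fintype.card J)) := by
        rw [ENNReal.ofReal_mul (by positivity), ENNReal.ofReal_natCast]
        simp only [Finset.sum_const, Finset.card_univ, nsmul_eq_mul]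
        rw [← Finset.mul_sum, ← Finset.sum_mul, hone, one_mul]
      _ ≤ ENNReal.ofReal (1 / (m : ℝ) ^ β) :=
        ENNReal.ofReal_le_ofReal (by
          -- For `J` empty the quotient is the junk value `0 / 0 = 0`, and the bound still holds.
          rw [mul_div_left_comm]
          exact mul_le_of_le_one_right hb (div_self_le_one _))
  have hreal : P.real {ω | ∃ j, E.emptyQueue (A ω) j t ω ≠ E.stationaryQueue (A ω) j t ω}
      ≤ 1 / (m : ℝ) ^ β := ENNReal.toReal_le_of_le_ofReal hb hbad
  refine ⟨?_, hreal⟩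
  -- The two events cover `Ω`, so no measurability is needed to pass to the complement.
  have hunion : (Set.univ : Set Ω)
      ⊆ {ω | ∀ j, E.emptyQueue (A ω) j t ω = E.stationaryQueue (A ω) j t ω}
        ∪ {ω | ∃ j, E.emptyQueue (A ω) j t ω ≠ E.stationaryQueue (A ω) j t ω} := by
    intro ω _
    by_cases h : ∀ j, E.emptyQueue (A ω) j t ω = E.stationaryQueue (A ω) j t ω
    · exact Or.inl h
    · exact Or.inr (not_forall.1 h)
  have hsum := (measureReal_mono (μ := P) hunion).trans (measureReal_union_le _ _)
  rw [probReal_univ] at hsum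
  linarith
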